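/- Let $X$ be a finite non-empty set of clocks and $\mathcal G$ a weighted timed game with finitely many locations and edges: each edge $e$ goes from a location to a location and carries a guard $g_e$ (a finite conjunction of constraints $x \bowtie c$ with $x\in X$, ${\bowtie}\in\{<,\le,>,\ge\}$ and integer $c$), a set $Y_e\subseteq X$ of clocks to reset and an integer weight $w(e)$, and each location $\ell$ has an integer weight $w(\ell)$. Clocks are bounded by a positive integer $M$ with $|c|\le M$ for all constants $c$ of guards: valuations range over $[0,M)^X$. A finite play is a sequence of consecutive transitions $(\ell,\nu)\xrightarrow{d,e}(\ell',\nu')$, where $e$ is an edge from $\ell$ to $\ell'$, $d\ge 0$, $\nu+d\in[0,M)^X$ satisfies $g_e$, and $\nu'=(\nu+d)[Y_e:=0]$; its cumulative weight is the sum of the numbers $d\cdot w(\ell)+w(e)$ over its transitions. Regions are the classes of valuations of $[0,M)^X$ with the same integral parts, the same clocks with zero fractional part, and the same ordering of the fractional parts. The region game $\mathcal R(\mathcal G)$ has as states the pairs $(\ell,r)$ of a location and a region, and as edges the transitions $(\ell,r)\xrightarrow{r'',e}(\ell',r')$ where $e$ is an edge of $\mathcal G$ from $\ell$ to $\ell'$,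 $r''$ is a region containing $\nu+d$ for some $\nu\in r$ and $d\ge0$, all valuations of $r''$ satisfy $g_e$, and $r''[Y_e:=0]=r'$. A play of $\mathcal G$ follows a path of $\mathcal R(\mathcal G)$ if, transition by transition, it uses the edge $e$ and $\nu\in r$, $\nu+d\in r''$, $\nu'\in r'$. A cycle of $\mathcal R(\mathcal G)$ is a non-empty path that ends in its first state; it is simple if no state is repeated except for this return; it is a $0$-cycle if every finite play following it has cumulative weight $0$. A decomposition of a cycle $\rho=\rho_1\rho_2\rho_3$ (with $\rho_2,\rho_3$ non-empty and $\rho_2$ a cycle) is the pair of cycles $\rho'=\rho_3\rho_1$, $\rho''=\rho_2$. The game $\mathcal G$ is almost-divergent if every finite play following a cycle $\rho$ of $\mathcal R(\mathcal G)$ has cumulative weight in $(-\infty,-1]\cup\{0\}\cup[1,+\infty)$ and, whenever this weight is $0$, for every decomposition of $\rho$ into cycles $\rho',\rho''$, all plays following $\rho'$ and $\rho''$ have cumulative weight $0$. The kernel of $\mathcal G$ is the subgraph of $\mathcal R(\mathcal G)$ formed by all edges that belong to a simple $0$-cycle, and the states covered by these edges. Proposition. If $\mathcal G$ is almost-divergent,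 then a cycle of $\mathcal R(\mathcal G)$ lies entirely in the kernel if and only if it is a $0$-cycle. -/

import Mathlib

/-! Clock constraints -/

/-- Comparison operators of atomic constraints. -/
inductive Cmp where
  | lt | le | gt | ge

/-- `a ⋈ b`. -/
def Cmp.Holds : Cmp → ℝ → ℝ → Prop
  | .lt, a, b => a < b
  | .le, a, b => a ≤ b
  | .gt, a, b => a > b
  | .ge, a, b => a ≥ b

/-- Atomic constraints over the clocks `X`: `x ⋈ c`, or the diagonal form `x - y ⋈ c`. -/
inductive AtomicConstraint (X : Type*) where
  | single (x : X) (op : Cmp) (c : ℚ)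
  | diagonal (x y : X) (op : Cmp) (c : ℚ)

namespace AtomicConstraint

variable {X : Type*}

def Sat (ν : X → ℝ) : AtomicConstraint X → Prop
  | single x op c => op.Holds (ν x) c
  | diagonal x y op c => op.Holds (ν x - ν y) c

def const : AtomicConstraint X → ℚ
  | single _ _ c => c
  | diagonal _ _ _ c => c

def NonDiagonal : AtomicConstraint X → Prop
  | single _ _ _ => True
  | diagonal _ _ _ _ => False

end AtomicConstraint

/-- A guard is a finite conjunction of atomic constraints. -/
abbrev Guard (X : Type*) := List (AtomicConstraint X)

/-- `ν ⊨ g`. -/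
def Guard.Sat {X : Type*} (g : Guard X) (ν : X → ℝ) : Prop := ∀ a ∈ g, a.Sat ν

/-- The set of valuations (non-negative on every clock) satisfying `g`. -/
def Guard.zone {X : Type*} (g : Guard X) : Set (X → ℝ) :=
  {ν | (∀ x, 0 ≤ ν x) ∧ g.Sat ν}

/-! Valuations and regions -/

/-- `ν + d`. -/
def elapse {X : Type*} (ν : X → ℝ) (d : ℝ) : X → ℝ := fun x => ν x + d

open Classical in
/-- `ν[Y := 0]`. -/
noncomputable def resetClocks {X : Type*} (Y : Set X) (ν : X → ℝ) : X → ℝ :=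
  fun x => if x ∈ Y then 0 else ν x

/-- The bounded valuations `[0, M)^X`. -/
def clockBox (X : Type*) (M : ℕ) : Set (X → ℝ) := {ν | ∀ x, 0 ≤ ν x ∧ ν x < M}

/-- Region equivalence of bounded valuations: same integral parts, same clocks with zero
fractional part, same ordering of the fractional parts. -/
def RegionEquiv {X : Type*} (μ ν : X → ℝ) : Prop :=
  (∀ x, ⌊μ x⌋ = ⌊ν x⌋) ∧
  (∀ x, Int.fract (μ x) = 0 ↔ Int.fract (ν x) = 0) ∧
  (∀ x y, Int.fract (μ x) ≤ Int.fract (μ y) ↔ Int.fract (ν x) ≤ Int.fract (ν y))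

/-- The regions (of granularity `1`) bounded by `M`: the classes of `RegionEquiv` in `[0, M)^X`. -/
def Region (X : Type*) (M : ℕ) : Type _ :=
  {r : Set (X → ℝ) // ∃ μ ∈ clockBox X M, r = {ν | ν ∈ clockBox X M ∧ RegionEquiv μ ν}}

/-- The set of valuations of a region. -/
def Region.carrier {X : Type*} {M : ℕ} (r : Region X M) : Set (X → ℝ) := r.1

/-- `r'` is a time successor of `r`. Zero delays are possible in plays, so they are allowed here
too: every region is a time successor of itself. -/
def Region.TimeSucc {X : Type*} {M : ℕ} (r r' : Region X M) : Prop :=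
  ∃ ν ∈ r.carrier, ∃ d : ℝ, 0 ≤ d ∧ elapse ν d ∈ r'.carrier

/-- Every region is the zone of some guard. -/
theorem Region.exists_guard {X : Type*} [Finite X] {M : ℕ} (r : Region X M) :
    ∃ g : Guard X, g.zone = r.carrier := by
  classical
  have := Fintype.ofFinite X
  obtain ⟨r, μ, hμ, rfl⟩ := r
  refine ⟨(Finset.univ : Finset X).toList.flatMap (fun x =>
      [.single x .ge ⌊μ x⌋, .single x .lt (⌊μ x⌋ + 1),
        if Int.fract (μ x) = 0 then .single x .le ⌊μ x⌋ else .single x .gt ⌊μ x⌋]) ++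
    (Finset.univ : Finset (X × X)).toList.map (fun p =>
      if Int.fract (μ p.1) ≤ Int.fract (μ p.2)
        then .diagonal p.1 p.2 .le (⌊μ p.1⌋ - ⌊μ p.2⌋)
        else .diagonal p.1 p.2 .gt (⌊μ p.1⌋ - ⌊μ p.2⌋)), ?_⟩
  ext ν
  have key : ∀ x, ⌊μ x⌋ = ⌊ν x⌋ ↔ ((⌊μ x⌋ : ℝ) ≤ ν x ∧ ν x < ⌊μ x⌋ + 1) := fun x => by
    rw [eq_comm, Int.floor_eq_iff]
  simp only [Guard.zone, Guard.Sat, Region.carrier, RegionEquiv, Set.mem_ofPred_eq,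
    List.mem_append, List.mem_flatMap, List.mem_map, Finset.mem_toList, Finset.mem_univ, true_and]
  constructor
  · rintro ⟨h0, h⟩
    have h1 : ∀ x, (⌊μ x⌋ : ℝ) ≤ ν x := fun x => by
      have := h (.single x .ge ⌊μ x⌋) (Or.inl ⟨x, by simp⟩)
      simpa [AtomicConstraint.Sat, Cmp.Holds] using this
    have h2 : ∀ x, ν x < ⌊μ x⌋ + 1 := fun x => by
      have := h (.single x .lt (⌊μ x⌋ + 1)) (Or.inl ⟨x, by simp⟩)
      simpa [AtomicConstraint.Sat, Cmp.Holds] using this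
    have hf : ∀ x, ⌊μ x⌋ = ⌊ν x⌋ := fun x => (key x).2 ⟨h1 x, h2 x⟩
    have hν : ∀ x, Int.fract (ν x) = ν x - ⌊μ x⌋ := fun x => by rw [hf x]; rfl
    refine ⟨fun x => ⟨h0 x, ?_⟩, hf, fun x => ?_, fun x y => ?_⟩
    · have h3 : ⌊μ x⌋ < (M : ℤ) := Int.floor_lt.2 (by simpa using (hμ x).2)
      have h4 : (⌊μ x⌋ : ℝ) + 1 ≤ M := by exact_mod_cast h3
      linarith [h2 x]
    · have := h _ (Or.inl ⟨x, by simp only [List.mem_cons]; exact Or.inr (Or.inr (Or.inl rfl))⟩)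
      rw [hν]
      split_ifs at this with hc
      · simp only [AtomicConstraint.Sat, Cmp.Holds, Rat.cast_intCast] at this
        simp only [hc, true_iff]; linarith [h1 x]
      · simp only [AtomicConstraint.Sat, Cmp.Holds, Rat.cast_intCast] at this
        simp only [hc, false_iff]; intro h5; linarith
    · have := h _ (Or.inr ⟨(x, y), rfl⟩)
      rw [hν, hν]
      split_ifs at this with hc
      · simp [AtomicConstraint.Sat, Cmp.Holds] at this
        simp only [hc, true_iff]; linarith
      · simp [AtomicConstraint.Sat, Cmp.Holds] at this
        simp only [hc, false_iff]; intro h5; linarith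
  · rintro ⟨hb, hf, hz, ho⟩
    have hν : ∀ x, Int.fract (ν x) = ν x - ⌊μ x⌋ := fun x => by rw [hf x]; rfl
    refine ⟨fun x => (hb x).1, ?_⟩
    rintro a (⟨x, hx⟩ | ⟨p, rfl⟩)
    · obtain ⟨h1, h2⟩ := (key x).1 (hf x)
      have hzx := hz x
      rw [hν] at hzx
      simp only [List.mem_cons, List.not_mem_nil, or_false] at hx
      rcases hx with rfl | rfl | rfl
      · simpa [AtomicConstraint.Sat, Cmp.Holds] using h1
      · simpa [AtomicConstraint.Sat, Cmp.Holds] using h2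
      · split_ifs with hc
        · simp only [AtomicConstraint.Sat, Cmp.Holds, Rat.cast_intCast]
          linarith [hzx.1 hc]
        · simp only [AtomicConstraint.Sat, Cmp.Holds, Rat.cast_intCast]
          exact lt_of_le_of_ne h1 fun h5 => hc (hzx.2 (by linarith))
    · have hop := ho p.1 p.2
      rw [hν, hν] at hop
      split_ifs with hc
      · simp [AtomicConstraint.Sat, Cmp.Holds]
        linarith [hop.1 hc]
      · simp [AtomicConstraint.Sat, Cmp.Holds]
        have := lt_of_not_ge (fun h5 => hc (hop.2 h5))
        linarith

/-- An arbitrarily chosen guard whose zone is the region. -/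
noncomputable def Region.guard {X : Type*} [Finite X] {M : ℕ} (r : Region X M) : Guard X :=
  r.exists_guard.choose

/-! Weighted timed games -/

/-- A weighted timed game with locations `L`, clocks `X` and edges `E`. The locations outside
`locMin` belong to the second player. -/
structure WTG (L X E : Type*) where
  locMin : Set L
  target : Set L
  target_subset : target ⊆ locMin
  src : E → L
  guard : E → Guard X
  reset : E → Set X
  tgt : E → L
  locWeight : L → ℤ
  edgeWeight : E → ℤ
  finalWeight : target → (X → ℝ) → EReal

/-- A labelled transition between configurations (location, valuation). -/
structure TimedTransition (L X E : Type*) where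
  source : L × (X → ℝ)
  delay : ℝ
  edge : E
  target : L × (X → ℝ)

namespace WTG

variable {L X E : Type*}

/-- All guards are non-diagonal, with integer constants of absolute value at most `M`. -/
def GuardsBoundedBy (G : WTG L X E) (M : ℕ) : Prop :=
  ∀ e, ∀ a ∈ G.guard e, a.NonDiagonal ∧ (∃ c : ℤ, a.const = c) ∧ |a.const| ≤ M

/-! Paths in the underlying graph, as lists of edges -/

def IsPath (G : WTG L X E) (ρ : List E) : Prop :=
  ρ.IsChain (fun e e' => G.tgt e = G.src e')

/-- A cycle is a non-empty path that returns to its first location. -/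
def IsCycle (G : WTG L X E) (ρ : List E) : Prop :=
  G.IsPath ρ ∧ ∃ h : ρ ≠ [], G.tgt (ρ.getLast h) = G.src (ρ.head h)

/-- No location is visited twice (apart from the return to the first one). -/
def IsSimple (G : WTG L X E) (ρ : List E) : Prop := (ρ.map G.src).Nodup

/-- The cycle `ρ = ρ₁ρ₂ρ₃` decomposes into the smaller cycles `ρ' = ρ₃ρ₁` and `ρ'' = ρ₂`. -/
def IsDecomposition (G : WTG L X E) (ρ ρ' ρ'' : List E) : Prop :=
  ∃ ρ₁ ρ₂ ρ₃ : List E, ρ₃ ≠ [] ∧ ρ = ρ₁ ++ ρ₂ ++ ρ₃ ∧ ρ' = ρ₃ ++ ρ₁ ∧ ρ'' = ρ₂ ∧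
    G.IsCycle ρ' ∧ G.IsCycle ρ''

/-- A subgraph of the underlying graph. -/
structure Subgraph (G : WTG L X E) where
  states : Set L
  edges : Set E
  src_mem : ∀ e ∈ edges, G.src e ∈ states
  tgt_mem : ∀ e ∈ edges, G.tgt e ∈ states

/-- The path lies entirely in the subgraph. -/
def Subgraph.Contains {G : WTG L X E} (K : G.Subgraph) (ρ : List E) : Prop :=
  ∀ e ∈ ρ, e ∈ K.edges ∧ G.src e ∈ K.states ∧ G.tgt e ∈ K.states

/-! Semantics, with clocks bounded by `M` -/

/-- Valid transitions of the (bounded) infinite transition system. -/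
def IsTransition (G : WTG L X E) (M : ℕ) (t : TimedTransition L X E) : Prop :=
  0 ≤ t.delay ∧ t.source.1 = G.src t.edge ∧ t.target.1 = G.tgt t.edge ∧
  t.source.2 ∈ clockBox X M ∧ elapse t.source.2 t.delay ∈ clockBox X M ∧
  (G.guard t.edge).Sat (elapse t.source.2 t.delay) ∧
  t.target.2 = resetClocks (G.reset t.edge) (elapse t.source.2 t.delay)

/-- Finite plays, as lists of consecutive transitions. -/
def IsPlay (G : WTG L X E) (M : ℕ) (π : List (TimedTransition L X E)) : Prop :=
  (∀ t ∈ π, G.IsTransition M t) ∧ π.IsChain (fun t t' => t.target = t'.source)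

/-- The cumulative weight of a finite play. -/
def cumWeight (G : WTG L X E) (π : List (TimedTransition L X E)) : ℝ :=
  (π.map fun t => t.delay * (G.locWeight t.source.1 : ℝ) + (G.edgeWeight t.edge : ℝ)).sum

/-! Region abstraction and region game -/

/-- Transitions `(ℓ, r) --(r'', e)--> (ℓ', r')` of the region abstraction. -/
structure RegionTransition (G : WTG L X E) (M : ℕ) where
  source : L × Region X M
  mid : Region X M
  edge : E
  target : L × Region X M
  source_eq : source.1 = G.src edge
  target_eq : target.1 = G.tgt edge
  timeSucc : source.2.TimeSucc mid
  mid_sat : ∀ ν ∈ mid.carrier, (G.guard edge).Sat ν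
  reset_mid : resetClocks (G.reset edge) '' mid.carrier = target.2.carrier

/-- The region game: its locations are the region states, its edges the transitions of the
region abstraction. -/
noncomputable def regionGame [Finite X] (G : WTG L X E) (M : ℕ) :
    WTG (L × Region X M) X (G.RegionTransition M) where
  locMin := {s | s.1 ∈ G.locMin}
  target := {s | s.1 ∈ G.target}
  target_subset := fun _ hs => G.target_subset hs
  src := fun τ => τ.source
  guard := fun τ => τ.mid.guard
  reset := fun τ => G.reset τ.edge
  tgt := fun τ => τ.target
  locWeight := fun s => G.locWeight s.1
  edgeWeight := fun τ => G.edgeWeight τ.edge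
  finalWeight := fun s => G.finalWeight ⟨s.1.1, s.2⟩

/-- The play `π` of `G` follows the region path `ρ`. -/
def Follows {G : WTG L X E} {M : ℕ} (π : List (TimedTransition L X E))
    (ρ : List (G.RegionTransition M)) : Prop :=
  List.Forall₂ (fun t τ =>
    t.edge = τ.edge ∧
    t.source.1 = τ.source.1 ∧ t.source.2 ∈ τ.source.2.carrier ∧
    elapse t.source.2 t.delay ∈ τ.mid.carrier ∧
    t.target.1 = τ.target.1 ∧ t.target.2 ∈ τ.target.2.carrier) π ρ

/-- A region cycle is a `0`-cycle if all finite plays following it have cumulative weight `0`. -/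
def IsZeroCycle [Finite X] (G : WTG L X E) (M : ℕ) (ρ : List (G.RegionTransition M)) : Prop :=
  (G.regionGame M).IsCycle ρ ∧ ∀ π, G.IsPlay M π → Follows π ρ → G.cumWeight π = 0

/-- Almost-divergent weighted timed games. -/
def AlmostDivergent [Finite X] (G : WTG L X E) (M : ℕ) : Prop :=
  ∀ ρ : List (G.RegionTransition M), (G.regionGame M).IsCycle ρ →
    ∀ π, G.IsPlay M π → Follows π ρ →
      (G.cumWeight π ≤ -1 ∨ G.cumWeight π = 0 ∨ 1 ≤ G.cumWeight π) ∧
      (G.cumWeight π = 0 → ∀ ρ' ρ'', (G.regionGame M).IsDecomposition ρ ρ' ρ'' →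
        ∀ π' π'', G.IsPlay M π' → Follows π' ρ' → G.IsPlay M π'' → Follows π'' ρ'' →
          G.cumWeight π' = 0 ∧ G.cumWeight π'' = 0)

/-- The edges of the region game that belong to a simple `0`-cycle. -/
def kernelEdges [Finite X] (G : WTG L X E) (M : ℕ) : Set (G.RegionTransition M) :=
  {τ | ∃ ρ, G.IsZeroCycle M ρ ∧ (G.regionGame M).IsSimple ρ ∧ τ ∈ ρ}

/-- The kernel: the subgraph of the region game formed by `kernelEdges` and the region states
that they cover. -/
def kernel [Finite X] (G : WTG L X E) (M : ℕ) : (G.regionGame M).Subgraph where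
  states := {s | ∃ τ ∈ G.kernelEdges M, s = τ.source ∨ s = τ.target}
  edges := G.kernelEdges M
  src_mem := fun τ hτ => ⟨τ, hτ, Or.inl rfl⟩
  tgt_mem := fun τ hτ => ⟨τ, hτ, Or.inr rfl⟩

end WTG

/-! Time successors of regions -/

/-! The `0`-cycles are closed under three operations. Two based at the same state can be
concatenated, since weights add. Almost-divergence makes both parts of a decomposition `0`-cycles
(`IsZeroCycle.of_isDecomposition`). Rotation follows: if `uv` is a `0`-cycle then so is `uvuv =
u(vu)v`, and `vu` is a part of it. Splitting a `0`-cycle at repeated states until its parts are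
simple places all its edges in the kernel. Conversely, each edge of a kernel cycle `ρ` has a return
path closing a `0`-cycle; joining these along `ρ` gives a `0`-cycle `ρσ` with `σ` empty or a cycle,
so `ρ` is a `0`-cycle too. Almost-divergence speaks of actual plays, so every region cycle must be
followed by one. This holds because all valuations of a region can reach the same regions by
elapsing time. -/

theorem exists_cut_of_same_order {X : Type*} [Finite X] {f g : X → ℝ}
    (hg0 : ∀ x, 0 ≤ g x) (hg1 : ∀ x, g x < 1)
    (hz : ∀ x, f x = 0 ↔ g x = 0) (ho : ∀ x y, f x ≤ f y ↔ g x ≤ g y)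
    {t : ℝ} (ht0 : 0 < t) (ht1 : t < 1) :
    ∃ t', 0 < t' ∧ t' < 1 ∧ (∀ x, f x < t ↔ g x < t') ∧ (∀ x, f x = t ↔ g x = t') := by
  classical
  have := Fintype.ofFinite X
  have ho' : ∀ x y, f x < f y ↔ g x < g y := fun x y => by
    rw [← not_le, ← not_le, ho]
  by_cases h : ∃ x, f x = t
  · obtain ⟨x, rfl⟩ := h
    refine ⟨g x, lt_of_le_of_ne (hg0 x) fun h => ht0.ne' ((hz x).2 h.symm), hg1 x,
      fun y => ho' y x, fun y => ?_⟩
    rw [le_antisymm_iff, le_antisymm_iff, ho, ho]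
  · push Not at h
    -- When `f` misses `t`, any point between the `g`-values of the two sides works; adding `0` and
    -- `1` to these sets keeps it in the open unit interval.
    obtain ⟨t', hlo, hhi⟩ := Order.exists_between_finsets
      (insert 0 ((Finset.univ.filter fun x => f x < t).image g))
      (insert 1 ((Finset.univ.filter fun x => t < f x).image g)) (by
        intro a ha b hb
        simp only [Finset.mem_insert, Finset.mem_image, Finset.mem_filter, Finset.mem_univ,
          true_and] at ha hb
        rcases ha with rfl | ⟨x, hx, rfl⟩ <;> rcases hb with rfl | ⟨y, hy, rfl⟩
        · exact one_pos
        · exact lt_of_le_of_ne (hg0 y) fun h => (ht0.trans hy).ne' ((hz y).2 h.symm)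
        · exact hg1 x
        · exact (ho' x y).1 (hx.trans hy))
    simp only [Finset.mem_insert, Finset.mem_image, Finset.mem_filter, Finset.mem_univ,
      true_and, forall_eq_or_imp, forall_exists_index, and_imp, forall_apply_eq_imp_iff₂]
      at hlo hhi
    refine ⟨t', hlo.1, hhi.1, fun x => ?_, fun x => ?_⟩
    · refine ⟨hlo.2 x, fun hx => ?_⟩
      by_contra hc
      exact lt_asymm hx (hhi.2 x (lt_of_le_of_ne (not_lt.1 hc) (h x).symm))
    · refine ⟨fun hx => absurd hx (h x), fun hx => ?_⟩
      rcases lt_or_gt_of_ne (h x) with hc | hc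
      · exact absurd hx (hlo.2 x hc).ne
      · exact absurd hx (hhi.2 x hc).ne'

theorem floor_fract_add_of_lt {a δ : ℝ} (hδ : 0 ≤ δ) (h : Int.fract a < 1 - δ) :
    ⌊a + δ⌋ = ⌊a⌋ ∧ Int.fract (a + δ) = Int.fract a + δ := by
  have h1 := Int.floor_add_fract a
  have h2 := Int.fract_nonneg a
  have h3 : ⌊a + δ⌋ = ⌊a⌋ := Int.floor_eq_iff.2 ⟨by linarith, by linarith⟩
  refine ⟨h3, ?_⟩
  rw [Int.fract, h3, Int.fract]
  ring

theorem floor_fract_add_of_le {a δ : ℝ} (hδ : δ < 1) (h : 1 - δ ≤ Int.fract a) :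
    ⌊a + δ⌋ = ⌊a⌋ + 1 ∧ Int.fract (a + δ) = Int.fract a + δ - 1 := by
  have h1 := Int.floor_add_fract a
  have h2 := Int.fract_lt_one a
  have h3 : ⌊a + δ⌋ = ⌊a⌋ + 1 :=
    Int.floor_eq_iff.2 ⟨by push_cast; linarith, by push_cast; linarith⟩
  refine ⟨h3, ?_⟩
  rw [Int.fract, h3, Int.fract]
  push_cast
  ring

namespace RegionEquiv

variable {X : Type*} {μ ν ξ : X → ℝ}

theorem symm (h : RegionEquiv μ ν) : RegionEquiv ν μ :=
  ⟨fun x => (h.1 x).symm, fun x => (h.2.1 x).symm, fun x y => (h.2.2 x y).symm⟩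

theorem trans (h : RegionEquiv μ ν) (h' : RegionEquiv ν ξ) : RegionEquiv μ ξ :=
  ⟨fun x => (h.1 x).trans (h'.1 x), fun x => (h.2.1 x).trans (h'.2.1 x),
    fun x y => (h.2.2 x y).trans (h'.2.2 x y)⟩

theorem elapse_intCast (h : RegionEquiv μ ν) (n : ℤ) :
    RegionEquiv (elapse μ n) (elapse ν n) := by
  simpa [RegionEquiv, elapse] using h

theorem mem_clockBox {M : ℕ} (h : RegionEquiv μ ν) (hμ : μ ∈ clockBox X M) :
    ν ∈ clockBox X M := fun x => by
  obtain ⟨h0, h1⟩ := hμ x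
  rw [← Int.floor_nonneg, h.1 x, Int.floor_nonneg] at h0
  refine ⟨h0, ?_⟩
  have h2 : ⌊μ x⌋ < (M : ℤ) := Int.floor_lt.2 (by simpa using h1)
  rw [h.1 x] at h2
  simpa using Int.floor_lt.1 h2

/-- After a delay `δ`, the clocks that have reached a new integer are those with fractional part at
least `1 - δ`, with equality when they are exactly on it. Hence `δ'` is chosen so that `1 - δ'` cuts
the fractional parts of `ν` where `1 - δ` cuts those of `μ`. -/
theorem exists_elapse_of_lt_one [Finite X] (h : RegionEquiv μ ν) {δ : ℝ} (h0 : 0 ≤ δ)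
    (h1 : δ < 1) : ∃ δ', 0 ≤ δ' ∧ RegionEquiv (elapse μ δ) (elapse ν δ') := by
  rcases h0.eq_or_lt with rfl | h0
  · exact ⟨0, le_rfl, by simpa [RegionEquiv, elapse] using h⟩
  obtain ⟨hf, hz, ho⟩ := h
  obtain ⟨t, ht0, ht1, hlt, heq⟩ := exists_cut_of_same_order
    (fun x => Int.fract_nonneg (ν x)) (fun x => Int.fract_lt_one (ν x)) hz ho
    (sub_pos.2 h1) (sub_lt_self 1 h0)
  obtain ⟨δ', rfl⟩ : ∃ δ', t = 1 - δ' := ⟨1 - t, by ring⟩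
  have hδ0 : 0 < δ' := by linarith
  have hδ1 : δ' < 1 := by linarith
  have key : ∀ x,
      ((⌊μ x + δ⌋ = ⌊μ x⌋ ∧ Int.fract (μ x + δ) = Int.fract (μ x) + δ) ∧
        (⌊ν x + δ'⌋ = ⌊ν x⌋ ∧ Int.fract (ν x + δ') = Int.fract (ν x) + δ')) ∨
      ((⌊μ x + δ⌋ = ⌊μ x⌋ + 1 ∧ Int.fract (μ x + δ) = Int.fract (μ x) + δ - 1) ∧
        (⌊ν x + δ'⌋ = ⌊ν x⌋ + 1 ∧ Int.fract (ν x + δ') = Int.fract (ν x) + δ' - 1)) := by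
    intro x
    by_cases hc : Int.fract (μ x) < 1 - δ
    · exact Or.inl ⟨floor_fract_add_of_lt h0.le hc,
        floor_fract_add_of_lt hδ0.le ((hlt x).1 hc)⟩
    · exact Or.inr ⟨floor_fract_add_of_le h1 (not_lt.1 hc),
        floor_fract_add_of_le hδ1 (not_lt.1 (mt (hlt x).2 hc))⟩
  have hμ0 := fun x => Int.fract_nonneg (μ x)
  have hν0 := fun x => Int.fract_nonneg (ν x)
  have hμ1 := fun x => Int.fract_lt_one (μ x)
  have hν1 := fun x => Int.fract_lt_one (ν x)
  refine ⟨δ', hδ0.le, fun x => ?_, fun x => ?_, fun x y => ?_⟩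
  · simp only [elapse]
    rcases key x with ⟨⟨a, -⟩, b, -⟩ | ⟨⟨a, -⟩, b, -⟩ <;> rw [a, b, hf x]
  · simp only [elapse]
    rcases key x with ⟨⟨-, a⟩, -, b⟩ | ⟨⟨-, a⟩, -, b⟩ <;> rw [a, b]
    · exact iff_of_false (by linarith [hμ0 x]) (by linarith [hν0 x])
    · have := heq x
      constructor
      · intro hx; linarith [this.1 (by linarith)]
      · intro hx; linarith [this.2 (by linarith)]
  · simp only [elapse]
    -- Clocks on the same side of the cut keep their order. Otherwise the one that wrapped is now
    -- below the delay, and the other is at least the delay.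
    have := ho x y
    rcases key x with ⟨⟨-, a⟩, -, b⟩ | ⟨⟨-, a⟩, -, b⟩ <;>
      rcases key y with ⟨⟨-, c⟩, -, d⟩ | ⟨⟨-, c⟩, -, d⟩ <;> rw [a, b, c, d]
    · simpa using this
    · exact iff_of_false (by linarith [hμ0 x, hμ1 y]) (by linarith [hν0 x, hν1 y])
    · exact iff_of_true (by linarith [hμ1 x, hμ0 y]) (by linarith [hν1 x, hν0 y])
    · simpa using this

theorem exists_elapse [Finite X] (h : RegionEquiv μ ν) {d : ℝ} (hd : 0 ≤ d) :
    ∃ d', 0 ≤ d' ∧ RegionEquiv (elapse μ d) (elapse ν d') := by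
  obtain ⟨δ', h0, hδ⟩ := (h.elapse_intCast ⌊d⌋).exists_elapse_of_lt_one
    (Int.fract_nonneg d) (Int.fract_lt_one d)
  have he : ∀ (ξ : X → ℝ) (a b : ℝ), elapse (elapse ξ a) b = elapse ξ (a + b) :=
    fun ξ a b => funext fun x => add_assoc _ _ _
  rw [he, he, Int.floor_add_fract] at hδ
  exact ⟨_, add_nonneg (by exact_mod_cast Int.floor_nonneg.2 hd) h0, hδ⟩

end RegionEquiv

namespace Region

variable {X : Type*} {M : ℕ} {r r' : Region X M} {μ ν : X → ℝ}

theorem carrier_nonempty (r : Region X M) : r.carrier.Nonempty := by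
  obtain ⟨_, μ, hμ, rfl⟩ := r
  exact ⟨μ, hμ, fun _ => rfl, fun _ => Iff.rfl, fun _ _ => Iff.rfl⟩

theorem carrier_subset_clockBox (r : Region X M) : r.carrier ⊆ clockBox X M := by
  obtain ⟨_, μ, hμ, rfl⟩ := r
  exact fun _ h => h.1

theorem regionEquiv_of_mem (hμ : μ ∈ r.carrier) (hν : ν ∈ r.carrier) : RegionEquiv μ ν := by
  obtain ⟨_, ξ, hξ, rfl⟩ := r
  exact hμ.2.symm.trans hν.2

theorem mem_of_regionEquiv (hμ : μ ∈ r.carrier) (h : RegionEquiv μ ν) : ν ∈ r.carrier := by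
  obtain ⟨_, ξ, hξ, rfl⟩ := r
  exact ⟨h.mem_clockBox hμ.1, hμ.2.trans h⟩

/-- Lets a play continue from whichever valuation its previous transition produced. -/
theorem TimeSucc.exists_elapse_mem [Finite X] (h : r.TimeSucc r') (hν : ν ∈ r.carrier) :
    ∃ d : ℝ, 0 ≤ d ∧ elapse ν d ∈ r'.carrier := by
  obtain ⟨μ, hμ, d, hd, hμd⟩ := h
  obtain ⟨d', hd', he⟩ := (regionEquiv_of_mem hμ hν).exists_elapse hd
  exact ⟨d', hd', mem_of_regionEquiv hμd he⟩

end Region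

namespace WTG

variable {L X E : Type*}

/-! Walks with explicit endpoints -/

/-- The edge list `ρ` is a path from `s` to `t`. -/
def IsWalk (G : WTG L X E) : L → List E → L → Prop
  | s, [], t => s = t
  | s, e :: ρ, t => G.src e = s ∧ G.IsWalk (G.tgt e) ρ t

theorem isWalk_append {G : WTG L X E} {s t : L} {ρ σ : List E} :
    G.IsWalk s (ρ ++ σ) t ↔ ∃ m, G.IsWalk s ρ m ∧ G.IsWalk m σ t := by
  induction ρ generalizing s with
  | nil => simp [IsWalk]
  | cons e ρ ih => simp [IsWalk, ih, and_assoc]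

theorem isWalk_cons_iff {G : WTG L X E} {s t : L} {e : E} {ρ : List E} :
    G.IsWalk s (e :: ρ) t ↔
      G.src e = s ∧ G.IsPath (e :: ρ) ∧ G.tgt ((e :: ρ).getLast (List.cons_ne_nil _ _)) = t := by
  induction ρ generalizing s e with
  | nil => simp [IsWalk, IsPath]
  | cons e' ρ ih =>
    rw [IsWalk, ih]
    simp only [IsPath, List.isChain_cons_cons, List.getLast_cons_cons]
    constructor
    · rintro ⟨h1, h2, h3, h4⟩
      exact ⟨h1, ⟨h2.symm, h3⟩, h4⟩
    · rintro ⟨h1, ⟨h2, h3⟩, h4⟩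
      exact ⟨h1, h2.symm, h3, h4⟩

theorem isCycle_iff_isWalk {G : WTG L X E} {ρ : List E} :
    G.IsCycle ρ ↔ ρ ≠ [] ∧ ∃ s, G.IsWalk s ρ s := by
  cases ρ with
  | nil => simp [IsCycle]
  | cons e ρ => simp [IsCycle, isWalk_cons_iff, eq_comm]

theorem IsCycle.rotate {G : WTG L X E} {u v : List E} (h : G.IsCycle (u ++ v)) :
    G.IsCycle (v ++ u) := by
  rw [isCycle_iff_isWalk] at h ⊢
  obtain ⟨hne, s, hs⟩ := h
  obtain ⟨m, h1, h2⟩ := isWalk_append.1 hs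
  exact ⟨by simpa [and_comm] using hne, m, isWalk_append.2 ⟨s, h2, h1⟩⟩

theorem IsCycle.append {G : WTG L X E} {s : L} {ρ σ : List E} (hne : ρ ≠ [])
    (hρ : G.IsWalk s ρ s) (hσ : G.IsWalk s σ s) : G.IsCycle (ρ ++ σ) :=
  isCycle_iff_isWalk.2 ⟨by simp [hne], s, isWalk_append.2 ⟨s, hρ, hσ⟩⟩

theorem IsWalk.src_eq {G : WTG L X E} {s t : L} {e : E} {ρ : List E}
    (h : G.IsWalk s (e :: ρ) t) : s = G.src e := h.1.symm

theorem _root_.List.exists_split_of_not_nodup_map {α β : Type*} (f : α → β) {l : List α}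
    (h : ¬ (l.map f).Nodup) :
    ∃ l₁ a l₂ b l₃, l = l₁ ++ (a :: l₂) ++ (b :: l₃) ∧ f a = f b := by
  induction l with
  | nil => simp at h
  | cons a l ih =>
    rw [List.map_cons, List.nodup_cons, not_and_or, not_not] at h
    rcases h with h | h
    · obtain ⟨b, hb, hab⟩ := List.mem_map.1 h
      obtain ⟨l₂, l₃, rfl⟩ := List.append_of_mem hb
      exact ⟨[], a, l₂, b, l₃, by simp, hab.symm⟩
    · obtain ⟨l₁, c, l₂, b, l₃, rfl, hcb⟩ := ih h
      exact ⟨a :: l₁, c, l₂, b, l₃, by simp, hcb⟩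

theorem IsCycle.exists_isDecomposition {G : WTG L X E} {ρ : List E} (h : G.IsCycle ρ)
    (hs : ¬ G.IsSimple ρ) :
    ∃ ρ₁ ρ₂ ρ₃, ρ₂ ≠ [] ∧ ρ₃ ≠ [] ∧ ρ = ρ₁ ++ ρ₂ ++ ρ₃ ∧
      G.IsDecomposition ρ (ρ₃ ++ ρ₁) ρ₂ := by
  obtain ⟨ρ₁, a, l₂, b, l₃, rfl, hab⟩ := List.exists_split_of_not_nodup_map G.src hs
  obtain ⟨s, hw⟩ := (isCycle_iff_isWalk.1 h).2
  obtain ⟨m', h12, h3⟩ := isWalk_append.1 hw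
  obtain ⟨m, h1, h2⟩ := isWalk_append.1 h12
  -- Both cut points are the repeated state.
  obtain rfl : m = m' := h2.src_eq.trans (hab.trans h3.src_eq.symm)
  refine ⟨ρ₁, a :: l₂, b :: l₃, by simp, by simp, rfl, ρ₁, a :: l₂, b :: l₃, by simp, rfl, rfl,
    rfl, ?_, ?_⟩
  · exact isCycle_iff_isWalk.2 ⟨by simp, m, isWalk_append.2 ⟨s, h3, h1⟩⟩
  · exact isCycle_iff_isWalk.2 ⟨by simp, m, h2⟩

/-! Plays following region paths -/

/-- The play is built forwards; prescribing its initial configuration is what lets the induction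
glue the tail to the first transition. -/
theorem IsWalk.exists_play_cons [Finite X] {G : WTG L X E} {M : ℕ} {s t : L × Region X M}
    {τ : G.RegionTransition M} {ρ : List (G.RegionTransition M)}
    (h : (G.regionGame M).IsWalk s (τ :: ρ) t) {ν : X → ℝ} (hν : ν ∈ s.2.carrier) :
    ∃ u π, G.IsPlay M (u :: π) ∧ Follows (u :: π) (τ :: ρ) ∧ u.source = (s.1, ν) := by
  induction ρ generalizing s τ ν with
  | nil =>
    obtain ⟨rfl, -⟩ := h
    obtain ⟨d, hd, hm⟩ := τ.timeSucc.exists_elapse_mem hν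
    refine ⟨⟨(τ.source.1, ν), d, τ.edge,
      (τ.target.1, resetClocks (G.reset τ.edge) (elapse ν d))⟩, [], ⟨?_, by simp⟩, ?_, rfl⟩
    · simp only [List.mem_singleton, forall_eq]
      exact ⟨hd, τ.source_eq, τ.target_eq, Region.carrier_subset_clockBox _ hν,
        Region.carrier_subset_clockBox _ hm, τ.mid_sat _ hm, rfl⟩
    · exact .cons ⟨rfl, rfl, hν, hm, rfl, τ.reset_mid ▸ ⟨_, hm, rfl⟩⟩ .nil
  | cons τ' ρ ih =>
    obtain ⟨rfl, h⟩ := h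
    obtain ⟨d, hd, hm⟩ := τ.timeSucc.exists_elapse_mem hν
    have ht : resetClocks (G.reset τ.edge) (elapse ν d) ∈ τ.target.2.carrier :=
      τ.reset_mid ▸ ⟨_, hm, rfl⟩
    obtain ⟨u, π, ⟨hp, hc⟩, hf, hu⟩ := ih h ht
    refine ⟨⟨(τ.source.1, ν), d, τ.edge,
      (τ.target.1, resetClocks (G.reset τ.edge) (elapse ν d))⟩, u :: π, ⟨?_, ?_⟩, ?_, rfl⟩
    · intro v hv
      rcases List.mem_cons.1 hv with rfl | hv
      · exact ⟨hd, τ.source_eq, τ.target_eq, Region.carrier_subset_clockBox _ hν,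
          Region.carrier_subset_clockBox _ hm, τ.mid_sat _ hm, rfl⟩
      · exact hp v hv
    · exact List.isChain_cons_cons.2 ⟨hu.symm, hc⟩
    · exact .cons ⟨rfl, rfl, hν, hm, rfl, ht⟩ hf

theorem IsCycle.exists_play [Finite X] {G : WTG L X E} {M : ℕ}
    {ρ : List (G.RegionTransition M)} (h : (G.regionGame M).IsCycle ρ) :
    ∃ π, G.IsPlay M π ∧ Follows π ρ := by
  obtain ⟨hne, s, hs⟩ := isCycle_iff_isWalk.1 h
  obtain ⟨τ, ρ, rfl⟩ := List.exists_cons_of_ne_nil hne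
  obtain ⟨ν, hν⟩ := s.2.carrier_nonempty
  obtain ⟨u, π, hp, hf, -⟩ := hs.exists_play_cons hν
  exact ⟨u :: π, hp, hf⟩

/-! Zero cycles -/

variable [Finite X] {G : WTG L X E} {M : ℕ}

theorem IsZeroCycle.append {s : L × Region X M} {ρ σ : List (G.RegionTransition M)}
    (hρ : G.IsZeroCycle M ρ) (hσ : G.IsZeroCycle M σ)
    (hρs : (G.regionGame M).IsWalk s ρ s) (hσs : (G.regionGame M).IsWalk s σ s) :
    G.IsZeroCycle M (ρ ++ σ) := by
  refine ⟨IsCycle.append (isCycle_iff_isWalk.1 hρ.1).1 hρs hσs, fun π hπ hf => ?_⟩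
  have h1 := List.forall₂_take_append π ρ σ hf
  have h2 := List.forall₂_drop_append π ρ σ hf
  rw [← List.take_append_drop ρ.length π] at hπ ⊢
  obtain ⟨hc1, hc2, -⟩ := List.isChain_append.1 hπ.2
  rw [cumWeight, List.map_append, List.sum_append]
  have e1 := hρ.2 _ ⟨fun t ht => hπ.1 t (List.mem_append_left _ ht), hc1⟩ h1
  have e2 := hσ.2 _ ⟨fun t ht => hπ.1 t (List.mem_append_right _ ht), hc2⟩ h2
  rw [cumWeight] at e1 e2
  rw [e1, e2, add_zero]

theorem IsZeroCycle.of_isDecomposition (hdiv : G.AlmostDivergent M)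
    {ρ ρ' ρ'' : List (G.RegionTransition M)} (hρ : G.IsZeroCycle M ρ)
    (hd : (G.regionGame M).IsDecomposition ρ ρ' ρ'') :
    G.IsZeroCycle M ρ' ∧ G.IsZeroCycle M ρ'' := by
  obtain ⟨π, hπ, hf⟩ := hρ.1.exists_play
  have key := (hdiv ρ hρ.1 π hπ hf).2 (hρ.2 π hπ hf) ρ' ρ'' hd
  obtain ⟨_, _, _, -, -, -, -, h', h''⟩ := hd
  obtain ⟨π', hπ', hf'⟩ := h'.exists_play
  obtain ⟨π'', hπ'', hf''⟩ := h''.exists_play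
  -- `key` tests plays in pairs, so an arbitrary play of one part is paired with a fixed play of the
  -- other.
  exact ⟨⟨h', fun χ hχ hg => (key χ π'' hχ hg hπ'' hf'').1⟩,
    ⟨h'', fun χ hχ hg => (key π' χ hπ' hf' hχ hg).2⟩⟩

/-- A play following `uv` need not return to its initial valuation, so its two pieces cannot simply
be swapped; the cycle is doubled instead. -/
theorem IsZeroCycle.rotate (hdiv : G.AlmostDivergent M) {u v : List (G.RegionTransition M)}
    (h : G.IsZeroCycle M (u ++ v)) : G.IsZeroCycle M (v ++ u) := by
  rcases eq_or_ne v [] with rfl | hv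
  · simpa using h
  obtain ⟨s, hs⟩ := (isCycle_iff_isWalk.1 h.1).2
  refine ((h.append h hs hs).of_isDecomposition hdiv (ρ' := v ++ u) ?_).2
  exact ⟨u, v ++ u, v, hv, by simp, rfl, rfl, h.1.rotate, h.1.rotate⟩

theorem IsZeroCycle.subset_kernelEdges (hdiv : G.AlmostDivergent M)
    {ρ : List (G.RegionTransition M)} (h : G.IsZeroCycle M ρ) :
    ∀ τ ∈ ρ, τ ∈ G.kernelEdges M := by
  induction hn : ρ.length using Nat.strong_induction_on generalizing ρ with
  | _ n ih =>
    intro τ hτ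
    by_cases hs : (G.regionGame M).IsSimple ρ
    · exact ⟨ρ, h, hs, hτ⟩
    obtain ⟨ρ₁, ρ₂, ρ₃, h2, h3, rfl, hd⟩ := h.1.exists_isDecomposition hs
    obtain ⟨h', h''⟩ := h.of_isDecomposition hdiv hd
    have l2 := List.length_pos_iff.2 h2
    have l3 := List.length_pos_iff.2 h3
    simp only [List.length_append] at hn
    simp only [List.mem_append] at hτ
    rcases hτ with (hτ | hτ) | hτ
    · exact ih _ (by simp only [List.length_append]; omega) h' rfl τ
        (List.mem_append_right _ hτ)
    · exact ih _ (by omega) h'' rfl τ hτ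
    · exact ih _ (by simp only [List.length_append]; omega) h' rfl τ
        (List.mem_append_left _ hτ)

theorem exists_isZeroCycle_cons_of_mem_kernelEdges (hdiv : G.AlmostDivergent M)
    {τ : G.RegionTransition M} (h : τ ∈ G.kernelEdges M) : ∃ σ, G.IsZeroCycle M (τ :: σ) := by
  obtain ⟨ρ, hρ, -, hτ⟩ := h
  obtain ⟨u, v, rfl⟩ := List.append_of_mem hτ
  exact ⟨v ++ u, hρ.rotate hdiv⟩

/-- A non-empty path in the kernel extends to a `0`-cycle. -/
theorem exists_isZeroCycle_append_of_isWalk (hdiv : G.AlmostDivergent M)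
    {s t : L × Region X M} {τ : G.RegionTransition M} {ρ : List (G.RegionTransition M)}
    (hw : (G.regionGame M).IsWalk s (τ :: ρ) t) (hk : ∀ e ∈ τ :: ρ, e ∈ G.kernelEdges M) :
    ∃ σ, G.IsZeroCycle M (τ :: ρ ++ σ) := by
  induction ρ generalizing s τ with
  | nil => exact exists_isZeroCycle_cons_of_mem_kernelEdges hdiv (hk τ (by simp))
  | cons τ' ρ ih =>
    obtain ⟨σ, hσ⟩ := ih hw.2 fun e he => hk e (List.mem_cons_of_mem _ he)
    obtain ⟨χ, hχ⟩ := exists_isZeroCycle_cons_of_mem_kernelEdges hdiv (hk τ (by simp))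
    have hχ' : G.IsZeroCycle M (χ ++ [τ]) := IsZeroCycle.rotate (u := [τ]) hdiv hχ
    obtain ⟨a, ha⟩ := (isCycle_iff_isWalk.1 hσ.1).2
    obtain ⟨b, hb⟩ := (isCycle_iff_isWalk.1 hχ'.1).2
    obtain rfl : a = b := by
      obtain ⟨_, -, -, hb'⟩ := isWalk_append.1 hb
      exact ha.src_eq.trans (hw.2.src_eq.symm.trans hb')
    -- Both cycles are based at the target of `τ`. Rotating the final `τ` of the concatenation to
    -- the front gives `τ τ' ρ σ χ`.
    have h := hσ.append hχ' ha hb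
    rw [← List.append_assoc] at h
    exact ⟨σ ++ χ, by simpa using h.rotate hdiv⟩

theorem isZeroCycle_of_subset_kernelEdges (hdiv : G.AlmostDivergent M)
    {ρ : List (G.RegionTransition M)} (hρ : (G.regionGame M).IsCycle ρ)
    (hk : ∀ e ∈ ρ, e ∈ G.kernelEdges M) : G.IsZeroCycle M ρ := by
  obtain ⟨hne, s, hs⟩ := isCycle_iff_isWalk.1 hρ
  obtain ⟨τ, ρ, rfl⟩ := List.exists_cons_of_ne_nil hne
  obtain ⟨σ, hσ⟩ := exists_isZeroCycle_append_of_isWalk hdiv hs hk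
  rcases eq_or_ne σ [] with rfl | hσne
  · simpa using hσ
  -- Decomposition with empty first factor: as `τ :: ρ` returns to `s`, the remainder `σ` is a cycle
  -- at `s`.
  refine (hσ.of_isDecomposition hdiv (ρ' := σ ++ []) (ρ'' := τ :: ρ)
    ⟨[], τ :: ρ, σ, hσne, rfl, rfl, rfl, ?_, hρ⟩).2
  obtain ⟨a, ha⟩ := (isCycle_iff_isWalk.1 hσ.1).2
  obtain ⟨m, h1, h2⟩ := isWalk_append.1 ha
  obtain rfl : a = s := h1.src_eq.trans hs.src_eq.symm
  obtain rfl : m = a :=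
    (isWalk_cons_iff.1 h1).2.2.symm.trans (isWalk_cons_iff.1 hs).2.2
  rw [List.append_nil]
  exact isCycle_iff_isWalk.2 ⟨hσne, m, h2⟩

end WTG

theorem mainTheorem7 {L X E : Type*} [Finite L] [Finite X] [Nonempty X] [Finite E]
    (G : WTG L X E) (M : ℕ) (hM : 0 < M) (hguards : G.GuardsBoundedBy M)
    (hdiv : G.AlmostDivergent M)
    (ρ : List (G.RegionTransition M)) (hρ : (G.regionGame M).IsCycle ρ) :
    (G.kernel M).Contains ρ ↔ G.IsZeroCycle M ρ := by
  refine ⟨fun h => WTG.isZeroCycle_of_subset_kernelEdges hdiv hρ fun e he => (h e he).1,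
    fun h τ hτ => ?_⟩
  have hτ := h.subset_kernelEdges hdiv τ hτ
  exact ⟨hτ, (G.kernel M).src_mem τ hτ, (G.kernel M).tgt_mem τ hτ⟩
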